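/- Let $k=\mathbb C$. For $n\ge 0$ let $\mathbb B_n=\mathbb Z_2^n\rtimes\mathbb S_n$ be the classical Weyl group, with product $(a,\tau)(b,\mu)=(a+\tau\cdot b,\tau\mu)$, where $(\tau\cdot b)_i=b_{\tau^{-1}(i)}$. For a finite group $G$, an element $s\in G$ and a representation $\rho$ of the centralizer $G^s$ on a complex vector space $V$, let $\mathcal O_s^G$ be the conjugacy class of $s$, choose for each $t\in\mathcal O_s^G$ an element $g_t\in G$ with $g_t s g_t^{-1}=t$, and let $M(\mathcal O_s^G,\rho)=\bigoplus_{t\in\mathcal O_s^G} g_t\otimes V$ be the Yetter–Drinfeld module over $kG$ with action $h\cdot(g_tv)=g_{t'}(\gamma\cdot v)$, where $t'=hth^{-1}$ and $hg_t=g_{t'}\gamma$ with $\gamma\in G^s$, and coaction $\delta(g_tv)=t\otimes g_tv$. Let $\mathfrak B(\mathcal O_s^G,\rho)$ denote the Nichols algebra of $M=M(\mathcal O_s^G,\rho)$, that is, the quotient of the tensor algebra $T(M)$ by the sum of all its homogeneous two-sided ideals that lie in degrees $\ge 2$ and are coideals for the braided comultiplication of $T(M)$ (for which the elements of $M$ are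 primitive). **Lemma.** Let $(a,\tau)\in\mathbb B_n$, let $\bar a=(a_1,\dots,a_n,0)\in\mathbb Z_2^{n+1}$, and regard $\tau$ also as the element of $\mathbb S_{n+1}$ that fixes $n+1$. If $\dim\mathfrak B(\mathcal O_{(a,\tau)}^{\mathbb B_n},\rho)=\infty$ for every irreducible representation $\rho$ of the centralizer $\mathbb B_n^{(a,\tau)}$, then $\dim\mathfrak B(\mathcal O_{(\bar a,\tau)}^{\mathbb B_{n+1}},\mu)=\infty$ for every irreducible representation $\mu$ of the centralizer $\mathbb B_{n+1}^{(\bar a,\tau)}$. -/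

import Mathlib

open scoped TensorProduct MonoidAlgebra

universe u

noncomputable section

/-! ### Yetter–Drinfeld modules over a group algebra -/

/-- The `k`-linear map `x ↦ h x h⁻¹` of the group algebra `k[G]`. -/
def groupAlgebraConj (k : Type*) {G : Type*} [Field k] [Group G] (h : G) : k[G] →ₗ[k] k[G] :=
  LinearMap.mulLeft k (MonoidAlgebra.of k G h) ∘ₗ LinearMap.mulRight k (MonoidAlgebra.of k G h⁻¹)

/-- A (left-left) Yetter–Drinfeld module structure over the group algebra `k[G]` on a vector space
`M`: a left action of `G`, and a left coaction of the coalgebra `k[G]` (group elements are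
group-like), such that `δ (h · x) = h x₍₋₁₎ h⁻¹ ⊗ h · x₍₀₎`. -/
structure YetterDrinfeld (k G M : Type*) [Field k] [Group G] [AddCommGroup M] [Module k M] where
  /-- the action of `G` -/
  act : Representation k G M
  /-- the coaction `δ` of `k[G]` -/
  coact : M →ₗ[k] k[G] ⊗[k] M
  counit : (TensorProduct.lid k M).toLinearMap ∘ₗ
      LinearMap.rTensor M (Coalgebra.counit (R := k) (A := k[G])) ∘ₗ coact = LinearMap.id
  coassoc : (TensorProduct.assoc k k[G] k[G] M).toLinearMap ∘ₗ
      LinearMap.rTensor M (Coalgebra.comul (R := k) (A := k[G])) ∘ₗ coact =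
        LinearMap.lTensor k[G] coact ∘ₗ coact
  compat : ∀ h : G, coact ∘ₗ act h = TensorProduct.map (groupAlgebraConj k h) (act h) ∘ₗ coact

namespace YetterDrinfeld

variable {k G M : Type*} [Field k] [Group G] [AddCommGroup M] [Module k M]

/-- The braiding `c (x ⊗ y) = x₍₋₁₎ · y ⊗ x₍₀₎` of a Yetter–Drinfeld module. -/
def braiding (Y : YetterDrinfeld k G M) : M ⊗[k] M →ₗ[k] M ⊗[k] M :=
  LinearMap.rTensor M (TensorProduct.lift Y.act.asAlgebraHom.toLinearMap) ∘ₗ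
    (TensorProduct.assoc k k[G] M M).symm.toLinearMap ∘ₗ
      LinearMap.lTensor k[G] (TensorProduct.comm k M M).toLinearMap ∘ₗ
        (TensorProduct.assoc k k[G] M M).toLinearMap ∘ₗ LinearMap.rTensor M Y.coact

/-! ### The Nichols algebra of a Yetter–Drinfeld module -/

/-- The action of `G` on the tensor algebra `T(M)` by algebra automorphisms. -/
def tensorAct (Y : YetterDrinfeld k G M) : Representation k G (TensorAlgebra k M) where
  toFun h := (TensorAlgebra.lift k (TensorAlgebra.ι k ∘ₗ Y.act h)).toLinearMap
  map_one' := by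
    have : TensorAlgebra.lift k (TensorAlgebra.ι k ∘ₗ Y.act 1) = AlgHom.id k _ := by
      ext x; simp
    rw [this]; rfl
  map_mul' g h := by
    have : TensorAlgebra.lift k (TensorAlgebra.ι k ∘ₗ Y.act (g * h)) =
        (TensorAlgebra.lift k (TensorAlgebra.ι k ∘ₗ Y.act g)).comp
          (TensorAlgebra.lift k (TensorAlgebra.ι k ∘ₗ Y.act h)) := by
      ext x; simp
    rw [this]; rfl

/-- For `v ∈ M`, left multiplication by `v ⊗ 1 + 1 ⊗ v` in the braided tensor product algebra
`T(M) ⊗ T(M)`, whose product is `(a ⊗ b) (c ⊗ d) = a (b₍₋₁₎ · c) ⊗ b₍₀₎ d`. Thus it sends `a ⊗ b` to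
`v a ⊗ b + (v₍₋₁₎ · a) ⊗ v₍₀₎ b`. -/
def comulGen (Y : YetterDrinfeld k G M) :
    M →ₗ[k] Module.End k (TensorAlgebra k M ⊗[k] TensorAlgebra k M) :=
  LinearMap.rTensorHom (TensorAlgebra k M) ∘ₗ LinearMap.mul k (TensorAlgebra k M) ∘ₗ
      TensorAlgebra.ι k +
    TensorProduct.homTensorHomMap (RingHom.id k) (TensorAlgebra k M) (TensorAlgebra k M) (TensorAlgebra k M)
        (TensorAlgebra k M) ∘ₗ
      TensorProduct.map Y.tensorAct.asAlgebraHom.toLinearMap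
        (LinearMap.mul k (TensorAlgebra k M) ∘ₗ TensorAlgebra.ι k) ∘ₗ Y.coact

/-- The braided comultiplication `Δ : T(M) → T(M) ⊗ T(M)`, that is, the algebra map into the braided
tensor product algebra with `Δ v = v ⊗ 1 + 1 ⊗ v` for `v ∈ M`. It is written through left
multiplication operators: `Δ (v₁ ⋯ vₘ) = (Δ v₁) ⋯ (Δ vₘ) (1 ⊗ 1)`. -/
def comul (Y : YetterDrinfeld k G M) :
    TensorAlgebra k M →ₗ[k] TensorAlgebra k M ⊗[k] TensorAlgebra k M :=
  LinearMap.applyₗ ((1 : TensorAlgebra k M) ⊗ₜ[k] (1 : TensorAlgebra k M)) ∘ₗ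
    (TensorAlgebra.lift k Y.comulGen).toLinearMap

theorem comul_one (Y : YetterDrinfeld k G M) : Y.comul 1 = 1 ⊗ₜ[k] 1 := by
  simp [comul]

theorem comul_ι_mul (Y : YetterDrinfeld k G M) (v : M) (x : TensorAlgebra k M) :
    Y.comul (TensorAlgebra.ι k v * x) = Y.comulGen v (Y.comul x) := by
  simp [comul]

theorem comulGen_of_coact (Y : YetterDrinfeld k G M) {v : M} {g : G}
    (hv : Y.coact v = MonoidAlgebra.of k G g ⊗ₜ[k] v) (a b : TensorAlgebra k M) :
    Y.comulGen v (a ⊗ₜ[k] b) = (TensorAlgebra.ι k v * a) ⊗ₜ[k] b +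
      Y.tensorAct g a ⊗ₜ[k] (TensorAlgebra.ι k v * b) := by
  simp [comulGen, hv]

/-- The subspace `I ⊗ T(M) + T(M) ⊗ I` of `T(M) ⊗ T(M)`. -/
def coidealSpace (I : Ideal (TensorAlgebra k M)) :
    Submodule k (TensorAlgebra k M ⊗[k] TensorAlgebra k M) :=
  LinearMap.range (LinearMap.rTensor (TensorAlgebra k M) (I.restrictScalars k).subtype) ⊔
    LinearMap.range (LinearMap.lTensor (TensorAlgebra k M) (I.restrictScalars k).subtype)

/-- The homogeneous two-sided ideals of the tensor algebra `T(M)` that lie in degrees at least two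
and are coideals for the braided comultiplication. -/
structure IsNicholsCoideal (Y : YetterDrinfeld k G M) (I : Ideal (TensorAlgebra k M)) : Prop where
  twoSided : I.IsTwoSided
  homogeneous : I.IsHomogeneous
    ((LinearMap.range (TensorAlgebra.ι k : M →ₗ[k] TensorAlgebra k M) ^ ·) :
      ℕ → Submodule k (TensorAlgebra k M))
  degree : I.restrictScalars k ≤
    ⨆ m : ℕ, ⨆ _ : 2 ≤ m, LinearMap.range (TensorAlgebra.ι k : M →ₗ[k] TensorAlgebra k M) ^ m
  coideal : ∀ x ∈ I, Y.comul x ∈ coidealSpace I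

/-- The defining ideal of the Nichols algebra: the sum of all homogeneous two-sided ideals of `T(M)`
in degrees at least two that are coideals. -/
def nicholsIdeal (Y : YetterDrinfeld k G M) : Ideal (TensorAlgebra k M) :=
  sSup {I | Y.IsNicholsCoideal I}

instance nicholsIdeal_isTwoSided (Y : YetterDrinfeld k G M) : Y.nicholsIdeal.IsTwoSided where
  mul_mem_of_left {a} b ha := by
    rw [nicholsIdeal, sSup_eq_iSup'] at ha ⊢
    induction ha using Submodule.iSup_induction' with
    | mem I x hx =>
      have := I.2.twoSided
      exact (le_iSup (fun J : {I | Y.IsNicholsCoideal I} => (J : Ideal (TensorAlgebra k M))) I)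
        (Ideal.mul_mem_right b _ hx)
    | zero => simp
    | add x y _ _ hx hy => rw [add_mul]; exact add_mem hx hy

/-- The Nichols algebra `𝔅(M) = T(M) / I(M)`. -/
abbrev NicholsAlgebra (Y : YetterDrinfeld k G M) : Type _ := TensorAlgebra k M ⧸ Y.nicholsIdeal

end YetterDrinfeld

/-! ### The Yetter–Drinfeld module of a conjugacy class and a representation of the centralizer -/

/-- A choice, for each `t` in the conjugacy class `𝒪ₛ` of `s`, of an element `g t` of the group with
`(g t) s (g t)⁻¹ = t`. -/
structure ConjTransversal {G : Type*} [Group G] (s : G) where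
  g : conjugatesOf s → G
  conj : ∀ t, g t * s * (g t)⁻¹ = t

theorem ConjTransversal.nonempty {G : Type*} [Group G] (s : G) : Nonempty (ConjTransversal s) := by
  have h : ∀ t : conjugatesOf s, ∃ g : G, g * s * g⁻¹ = t := fun t => isConj_iff.1 t.2
  choose g hg using h
  exact ⟨⟨g, hg⟩⟩

namespace ConjTransversal

variable {G : Type*} [Group G] {s : G}

/-- Conjugation `t ↦ h t h⁻¹` on the conjugacy class of `s`. -/
def conjBy (h : G) (t : conjugatesOf s) : conjugatesOf s :=
  ⟨h * t * h⁻¹, IsConj.trans t.2 (isConj_iff.2 ⟨h, rfl⟩)⟩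

/-- The element `γ` of the centralizer of `s` with `h (g t) = (g t') γ`, where `t' = h t h⁻¹`. -/
def cocycle (T : ConjTransversal s) (h : G) (t : conjugatesOf s) :
    Subgroup.centralizer ({s} : Set G) :=
  ⟨(T.g (conjBy h t))⁻¹ * (h * T.g t), by
    rw [Subgroup.mem_centralizer_singleton_iff]
    have key : T.g (conjBy h t) * s * (T.g (conjBy h t))⁻¹ = h * (T.g t * s * (T.g t)⁻¹) * h⁻¹ := by
      rw [T.conj t, T.conj (conjBy h t)]; rfl
    generalize T.g (conjBy h t) = x at key ⊢
    generalize T.g t = y at key ⊢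
    calc x⁻¹ * (h * y) * s = x⁻¹ * (h * (y * s * y⁻¹) * h⁻¹) * (h * y) := by group
      _ = s * (x⁻¹ * (h * y)) := by rw [← key]; group⟩

theorem mul_g (T : ConjTransversal s) (h : G) (t : conjugatesOf s) :
    h * T.g t = T.g (conjBy h t) * T.cocycle h t := by
  simp [cocycle]

theorem conjBy_one (t : conjugatesOf s) : conjBy 1 t = t := by
  ext; simp [conjBy]

theorem conjBy_mul (g h : G) (t : conjugatesOf s) : conjBy (g * h) t = conjBy g (conjBy h t) := by
  ext; simp [conjBy, mul_assoc]

theorem cocycle_one (T : ConjTransversal s) (t : conjugatesOf s) : T.cocycle 1 t = 1 := by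
  ext; simp [cocycle, conjBy_one]

theorem cocycle_mul (T : ConjTransversal s) (g h : G) (t : conjugatesOf s) :
    T.cocycle (g * h) t = T.cocycle g (conjBy h t) * T.cocycle h t := by
  ext; simp [cocycle, conjBy_mul, mul_assoc]

variable {k V : Type*} [Field k] [AddCommGroup V] [Module k V]

/-- The action `h · (g_t v) = g_{t'} (γ · v)` of `G` on `⨁ₜ g_t ⊗ V`, where `h g_t = g_{t'} γ` with
`γ` in the centralizer of `s`; the element `g_t v` is `Finsupp.single t v`. -/
def ydAct (T : ConjTransversal s)
    (ρ : Representation k (Subgroup.centralizer ({s} : Set G)) V) :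
    Representation k G (conjugatesOf s →₀ V) where
  toFun h := Finsupp.lsum k fun t => Finsupp.lsingle (conjBy h t) ∘ₗ ρ (T.cocycle h t)
  map_one' := by ext t v : 2; simp [conjBy_one, cocycle_one]
  map_mul' g h := by ext t v : 2; simp [conjBy_mul, cocycle_mul]

theorem ydAct_single (T : ConjTransversal s)
    (ρ : Representation k (Subgroup.centralizer ({s} : Set G)) V) (h : G) (t : conjugatesOf s)
    (v : V) : T.ydAct ρ h (Finsupp.single t v) =
      Finsupp.single (conjBy h t) (ρ (T.cocycle h t) v) := by
  simp [ydAct]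

/-- The coaction `δ (g_t v) = t ⊗ g_t v`. -/
def ydCoact (k : Type*) (V : Type*) [Field k] [AddCommGroup V] [Module k V] (s : G) :
    (conjugatesOf s →₀ V) →ₗ[k] k[G] ⊗[k] (conjugatesOf s →₀ V) :=
  Finsupp.lsum k fun t =>
    TensorProduct.mk k k[G] (conjugatesOf s →₀ V) (MonoidAlgebra.of k G t) ∘ₗ Finsupp.lsingle t

theorem ydCoact_single (t : conjugatesOf s) (v : V) : ydCoact k V s (Finsupp.single t v) =
    MonoidAlgebra.of k G (t : G) ⊗ₜ[k] Finsupp.single t v := by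
  simp [ydCoact]

/-- The Yetter–Drinfeld module `M(𝒪ₛ, ρ) = ⨁ₜ g_t ⊗ V`, where `t` runs through the conjugacy class
`𝒪ₛ` and `ρ` is a representation of the centralizer of `s` on `V`. -/
def yd (T : ConjTransversal s) (ρ : Representation k (Subgroup.centralizer ({s} : Set G)) V) :
    YetterDrinfeld k G (conjugatesOf s →₀ V) where
  act := T.ydAct ρ
  coact := ydCoact k V s
  counit := by
    ext t v : 2
    simp [ydCoact_single]
  coassoc := by
    ext t v : 2
    simp [ydCoact_single]
  compat h := by
    ext t v : 2
    simp [ydCoact_single, ydAct_single, groupAlgebraConj, conjBy, mul_assoc]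

/-- The braiding is `c (g_t v ⊗ g_r w) = t · (g_r w) ⊗ g_t v`. -/
theorem yd_braiding (T : ConjTransversal s)
    (ρ : Representation k (Subgroup.centralizer ({s} : Set G)) V) (t r : conjugatesOf s)
    (v w : V) : (T.yd ρ).braiding (Finsupp.single t v ⊗ₜ[k] Finsupp.single r w) =
      Finsupp.single (conjBy (t : G) r) (ρ (T.cocycle t r) w) ⊗ₜ[k] Finsupp.single t v := by
  simp [YetterDrinfeld.braiding, yd, ydCoact_single, ydAct_single]

/-- The Nichols algebra `𝔅(𝒪ₛ, ρ)` of `M(𝒪ₛ, ρ)`. -/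
abbrev Nichols (T : ConjTransversal s)
    (ρ : Representation k (Subgroup.centralizer ({s} : Set G)) V) : Type _ :=
  (T.yd ρ).NicholsAlgebra

end ConjTransversal

/-! ### The classical Weyl groups `ℤ₂ⁿ ⋊ 𝕊ₙ` -/

/-- The group `ℤ₂ⁿ ⋊ 𝕊ₙ`, where `(τ · a) i = a (τ⁻¹ i)`. -/
abbrev WeylB (n : ℕ) : Type :=
  (Fin n → Multiplicative (ZMod 2)) ⋊[mulAutArrow] Equiv.Perm (Fin n)

/-- The element `(a, τ)` of `ℤ₂ⁿ ⋊ 𝕊ₙ`. -/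
def WeylB.mk {n : ℕ} (a : Fin n → ZMod 2) (τ : Equiv.Perm (Fin n)) : WeylB n :=
  ⟨fun i => Multiplicative.ofAdd (a i), τ⟩

theorem WeylB.mk_mul_mk {n : ℕ} (a b : Fin n → ZMod 2) (τ μ : Equiv.Perm (Fin n)) :
    WeylB.mk a τ * WeylB.mk b μ = WeylB.mk (fun i => a i + b (τ⁻¹ i)) (τ * μ) := by
  rfl

/-- The vector `(a₁, …, aₙ, 0)`. -/
def WeylB.extendVec {n : ℕ} (a : Fin n → ZMod 2) : Fin (n + 1) → ZMod 2 :=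
  Fin.snoc a 0

/-- The permutation of `n + 1` letters that agrees with `τ` on the first `n` letters and fixes the
last one. -/
def WeylB.extendPerm {n : ℕ} (τ : Equiv.Perm (Fin n)) : Equiv.Perm (Fin (n + 1)) where
  toFun := Fin.lastCases (Fin.last n) fun i => (τ i).castSucc
  invFun := Fin.lastCases (Fin.last n) fun i => (τ⁻¹ i).castSucc
  left_inv i := by induction i using Fin.lastCases <;> simp
  right_inv i := by induction i using Fin.lastCases <;> simp

end

/-!
The Nichols algebra is monotone under embeddings of Yetter–Drinfeld modules, even when the group
changes. Let `j : G →* G'` be a homomorphism and `f : M → M'` an injective linear map between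
Yetter–Drinfeld modules over `G` and `G'` that respects actions and coactions along `j`. The algebra
map `T(f) : T(M) → T(M')` is graded and commutes with the braided comultiplications
(`YetterDrinfeld.IsMorphismAlong.comul`), so the preimage of the defining ideal of `𝔅(M')` is again a
homogeneous two-sided coideal in degrees at least two
(`YetterDrinfeld.IsMorphismAlong.isNicholsCoideal_comap`). The quotient of `T(M)` by it embeds into
`𝔅(M')` and surjects onto `𝔅(M)`; hence `𝔅(M)` is finite-dimensional as soon as `𝔅(M')` is
(`YetterDrinfeld.IsMorphismAlong.finiteDimensional_nicholsAlgebra`).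

For an injective `j : G →* G'` with `G` finite and `s' = j s`, a nonzero representation `μ` of the
centralizer of `s'` restricts to the centralizer of `s`, where it contains an irreducible `ρ` by
Maschke's theorem. Writing `j (g_t) = g'_{j t} γ_t` with `γ_t` in the centralizer of `s'`, the map
`g_t v ↦ g'_{j t} (γ_t v)` embeds `M(𝒪_s, ρ)` into `M(𝒪_{s'}, μ)` along `j`
(`ConjTransversal.isMorphismAlong_ydMap`). The theorem is the case of the embedding
`(a, τ) ↦ ((a, 0), τ)` of `ℤ₂ⁿ ⋊ 𝕊ₙ` into `ℤ₂ⁿ⁺¹ ⋊ 𝕊ₙ₊₁`.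
-/

/-! ### The defining ideal of the Nichols algebra is a coideal -/

namespace YetterDrinfeld

variable {k G G' M M' : Type*} [Field k] [Group G] [Group G'] [AddCommGroup M] [Module k M]
  [AddCommGroup M'] [Module k M']

/-- If `I` is the kernel of `g`, then `I ⊗ T(M) + T(M) ⊗ I` is the kernel of `g ⊗ g`. The map `g` need
not be surjective, since tensoring over a field preserves injectivity. -/
theorem coidealSpace_eq_ker {B : Type*} [AddCommGroup B] [Module k B]
    (I : Ideal (TensorAlgebra k M)) (g : TensorAlgebra k M →ₗ[k] B)
    (hg : I.restrictScalars k = LinearMap.ker g) :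
    coidealSpace I = LinearMap.ker (TensorProduct.map g g) := by
  have hex : Function.Exact (I.restrictScalars k).subtype g.rangeRestrict := by
    rw [LinearMap.exact_iff, LinearMap.ker_rangeRestrict, ← hg, Submodule.range_subtype]
  have hs := g.surjective_rangeRestrict
  have hinj : Function.Injective
      (TensorProduct.map (LinearMap.range g).subtype (LinearMap.range g).subtype) :=
    TensorProduct.map_injective_of_flat_flat _ _ (Submodule.injective_subtype _)
      (Submodule.injective_subtype _)
  have hfac : TensorProduct.map g g =
      TensorProduct.map (LinearMap.range g).subtype (LinearMap.range g).subtype ∘ₗ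
        TensorProduct.map g.rangeRestrict g.rangeRestrict := by
    rw [← TensorProduct.map_comp]; rfl
  rw [hfac, LinearMap.ker_comp_of_ker_eq_bot _ (LinearMap.ker_eq_bot.2 hinj),
    TensorProduct.map_ker hex hs hex hs, sup_comm]
  rfl

theorem coidealSpace_mono {I J : Ideal (TensorAlgebra k M)} (h : I ≤ J) :
    coidealSpace I ≤ coidealSpace J := by
  rw [coidealSpace_eq_ker I (I.restrictScalars k).mkQ (by simp),
    coidealSpace_eq_ker J (J.restrictScalars k).mkQ (by simp)]
  have hIJ : I.restrictScalars k ≤ LinearMap.ker (J.restrictScalars k).mkQ := by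
    rw [Submodule.ker_mkQ]; exact h
  have : (J.restrictScalars k).mkQ = (I.restrictScalars k).liftQ _ hIJ ∘ₗ (I.restrictScalars k).mkQ :=
    ((I.restrictScalars k).liftQ_mkQ _ hIJ).symm
  rw [this, TensorProduct.map_comp]
  exact LinearMap.ker_le_ker_comp _ _

/-- The class of ideals that defines the Nichols algebra is closed under sums, so the largest such
ideal belongs to it. -/
theorem isNicholsCoideal_nicholsIdeal (Y : YetterDrinfeld k G M) :
    Y.IsNicholsCoideal Y.nicholsIdeal where
  twoSided := inferInstance
  homogeneous := Ideal.IsHomogeneous.sSup fun _ hI => hI.homogeneous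
  degree := by
    intro x hx
    rw [Submodule.restrictScalars_mem, nicholsIdeal, sSup_eq_iSup'] at hx
    induction hx using Submodule.iSup_induction' with
    | mem I x hx => exact I.2.degree hx
    | zero => exact zero_mem _
    | add x y _ _ hx hy => exact add_mem hx hy
  coideal := by
    intro x hx
    rw [nicholsIdeal, sSup_eq_iSup'] at hx
    induction hx using Submodule.iSup_induction' with
    | mem I x hx => exact coidealSpace_mono (le_sSup I.2) (I.2.coideal x hx)
    | zero => rw [map_zero]; exact zero_mem _
    | add x y _ _ hx hy => rw [map_add]; exact add_mem hx hy

/-! ### The graded algebra map of tensor algebras induced by a linear map -/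

theorem tensorAlgebraMap_mem_range_ι_pow (f : M →ₗ[k] M') (n : ℕ) {x : TensorAlgebra k M}
    (hx : x ∈ LinearMap.range (TensorAlgebra.ι k : M →ₗ[k] TensorAlgebra k M) ^ n) :
    TensorAlgebra.lift k (TensorAlgebra.ι k ∘ₗ f) x ∈
      LinearMap.range (TensorAlgebra.ι k : M' →ₗ[k] TensorAlgebra k M') ^ n := by
  have h := Submodule.mem_map_of_mem
    (f := (TensorAlgebra.lift k (TensorAlgebra.ι k ∘ₗ f)).toLinearMap) hx
  rw [Submodule.map_pow] at h
  have hle : Submodule.map (TensorAlgebra.lift k (TensorAlgebra.ι k ∘ₗ f)).toLinearMap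
      (LinearMap.range (TensorAlgebra.ι k)) ≤ LinearMap.range (TensorAlgebra.ι k) := by
    rintro _ ⟨_, ⟨m, rfl⟩, rfl⟩
    exact ⟨f m, by simp⟩
  have hpow := pow_le_pow_left' hle n
  exact hpow h

theorem decompose_tensorAlgebraMap (f : M →ₗ[k] M') (x : TensorAlgebra k M) (n : ℕ) :
    (DirectSum.decompose ((LinearMap.range (TensorAlgebra.ι k : M' →ₗ[k] TensorAlgebra k M') ^ ·) :
      ℕ → Submodule k (TensorAlgebra k M')) (TensorAlgebra.lift k (TensorAlgebra.ι k ∘ₗ f) x) n :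
        TensorAlgebra k M') =
    TensorAlgebra.lift k (TensorAlgebra.ι k ∘ₗ f)
      (DirectSum.decompose ((LinearMap.range (TensorAlgebra.ι k : M →ₗ[k] TensorAlgebra k M) ^ ·) :
        ℕ → Submodule k (TensorAlgebra k M)) x n) := by
  induction x using DirectSum.Decomposition.inductionOn
    ((LinearMap.range (TensorAlgebra.ι k : M →ₗ[k] TensorAlgebra k M) ^ ·) :
        ℕ → Submodule k (TensorAlgebra k M)) with
  | zero => simp
  | @homogeneous i m =>
    have hm := tensorAlgebraMap_mem_range_ι_pow f i m.2
    by_cases h : i = n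
    · subst h
      rw [DirectSum.decompose_of_mem_same _ m.2, DirectSum.decompose_of_mem_same _ hm]
    · rw [DirectSum.decompose_of_mem_ne _ m.2 h, DirectSum.decompose_of_mem_ne _ hm h, map_zero]
  | add x y hx hy =>
    simp only [map_add, DirectSum.decompose_add, DirectSum.add_apply, Submodule.coe_add, hx, hy]

/-- An element lies in degrees at least two if and only if its components of degree `0` and `1`
vanish. -/
theorem mem_iSup_range_ι_pow_iff (x : TensorAlgebra k M) :
    x ∈ (⨆ m : ℕ, ⨆ _ : 2 ≤ m,
      LinearMap.range (TensorAlgebra.ι k : M →ₗ[k] TensorAlgebra k M) ^ m) ↔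
    ∀ n < 2, (DirectSum.decompose
      ((LinearMap.range (TensorAlgebra.ι k : M →ₗ[k] TensorAlgebra k M) ^ ·) :
        ℕ → Submodule k (TensorAlgebra k M)) x n : TensorAlgebra k M) = 0 := by
  classical
  constructor
  · intro hx n hn
    let p : Submodule k (TensorAlgebra k M) := LinearMap.ker (GradedAlgebra.proj
      ((LinearMap.range (TensorAlgebra.ι k : M →ₗ[k] TensorAlgebra k M) ^ ·) :
        ℕ → Submodule k (TensorAlgebra k M)) n)
    have : (⨆ m : ℕ, ⨆ _ : 2 ≤ m,
      LinearMap.range (TensorAlgebra.ι k : M →ₗ[k] TensorAlgebra k M) ^ m) ≤ p :=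
      iSup₂_le fun m hm y hy => DirectSum.decompose_of_mem_ne _ hy (by omega)
    exact this hx
  · intro h
    rw [← DirectSum.sum_support_decompose
      ((LinearMap.range (TensorAlgebra.ι k : M →ₗ[k] TensorAlgebra k M) ^ ·) :
        ℕ → Submodule k (TensorAlgebra k M)) x]
    refine Submodule.sum_mem _ fun m _ => ?_
    by_cases hm : 2 ≤ m
    · exact Submodule.mem_iSup_of_mem m (Submodule.mem_iSup_of_mem hm (SetLike.coe_mem _))
    · rw [h m (by omega)]; exact zero_mem _

/-- The map `T(f)` is injective in degrees `0` and `1` if `f` is injective. -/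
theorem tensorAlgebraMap_eq_zero {f : M →ₗ[k] M'} (hf : Function.Injective f) {n : ℕ} (hn : n < 2)
    {x : TensorAlgebra k M}
    (hx : x ∈ LinearMap.range (TensorAlgebra.ι k : M →ₗ[k] TensorAlgebra k M) ^ n)
    (h0 : TensorAlgebra.lift k (TensorAlgebra.ι k ∘ₗ f) x = 0) : x = 0 := by
  interval_cases n
  · rw [pow_zero] at hx
    obtain ⟨r, rfl⟩ := Submodule.mem_one.1 hx
    rw [AlgHom.commutes] at h0
    have : r = 0 := by
      simpa using congrArg TensorAlgebra.algebraMapInv h0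
    simp [this]
  · rw [pow_one] at hx
    obtain ⟨v, rfl⟩ := hx
    rw [TensorAlgebra.lift_ι_apply, LinearMap.comp_apply, TensorAlgebra.ι_eq_zero_iff] at h0
    rw [hf (h0.trans (map_zero f).symm), map_zero]

/-! ### Morphisms of Yetter–Drinfeld modules along a group homomorphism -/

/-- A linear map `f : M → M'` is a morphism along `j : G →* G'` from a Yetter–Drinfeld module over
`k[G]` to one over `k[G']` if `f (h · m) = j h · f m` and `δ' (f m) = j m₍₋₁₎ ⊗ f m₍₀₎`. -/
structure IsMorphismAlong (j : G →* G') (Y : YetterDrinfeld k G M) (Y' : YetterDrinfeld k G' M')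
    (f : M →ₗ[k] M') : Prop where
  act : ∀ h, f ∘ₗ Y.act h = Y'.act (j h) ∘ₗ f
  coact : Y'.coact ∘ₗ f =
    TensorProduct.map (MonoidAlgebra.mapDomainAlgHom k k j).toLinearMap f ∘ₗ Y.coact

namespace IsMorphismAlong

variable {j : G →* G'} {Y : YetterDrinfeld k G M} {Y' : YetterDrinfeld k G' M'} {f : M →ₗ[k] M'}

theorem tensorAct (H : IsMorphismAlong j Y Y' f) (h : G) (x : TensorAlgebra k M) :
    TensorAlgebra.lift k (TensorAlgebra.ι k ∘ₗ f) (Y.tensorAct h x) =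
      Y'.tensorAct (j h) (TensorAlgebra.lift k (TensorAlgebra.ι k ∘ₗ f) x) := by
  have : (TensorAlgebra.lift k (TensorAlgebra.ι k ∘ₗ f)).comp
        (TensorAlgebra.lift k (TensorAlgebra.ι k ∘ₗ Y.act h)) =
      (TensorAlgebra.lift k (TensorAlgebra.ι k ∘ₗ Y'.act (j h))).comp
        (TensorAlgebra.lift k (TensorAlgebra.ι k ∘ₗ f)) := by
    ext m
    simpa using congrArg (TensorAlgebra.ι k) (LinearMap.congr_fun (H.act h) m)
  exact DFunLike.congr_fun this x

/-- The map `T(f) ⊗ T(f)` intertwines left multiplication by `v ⊗ 1 + 1 ⊗ v` with left multiplication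
by `f v ⊗ 1 + 1 ⊗ f v` in the braided tensor product algebras. -/
theorem comulGen (H : IsMorphismAlong j Y Y' f) (v : M)
    (z : TensorAlgebra k M ⊗[k] TensorAlgebra k M) :
    TensorProduct.map (TensorAlgebra.lift k (TensorAlgebra.ι k ∘ₗ f)).toLinearMap
        (TensorAlgebra.lift k (TensorAlgebra.ι k ∘ₗ f)).toLinearMap (Y.comulGen v z) =
      Y'.comulGen (f v) (TensorProduct.map
        (TensorAlgebra.lift k (TensorAlgebra.ι k ∘ₗ f)).toLinearMap
        (TensorAlgebra.lift k (TensorAlgebra.ι k ∘ₗ f)).toLinearMap z) := by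
  have hco : Y'.coact (f v) = _ := LinearMap.congr_fun H.coact v
  induction z using TensorProduct.induction_on with
  | zero => simp
  | add x y hx hy => simp only [map_add, hx, hy]
  | tmul a b =>
    simp only [YetterDrinfeld.comulGen, LinearMap.add_apply, LinearMap.comp_apply, hco, map_add]
    congr 1
    · simp
    · generalize Y.coact v = c
      induction c using TensorProduct.induction_on with
      | zero => simp
      | add x y hx hy => simp only [map_add, LinearMap.add_apply, hx, hy]
      | tmul g m =>
        induction g using MonoidAlgebra.induction_linear with
        | zero => simp
        | add x y hx hy => simp only [map_add, LinearMap.add_apply, TensorProduct.add_tmul, hx, hy]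
        | single g r => simp [H.tensorAct]

/-- The algebra map `T(f)` is a map of coalgebras for the braided comultiplications. -/
theorem comul (H : IsMorphismAlong j Y Y' f) (x : TensorAlgebra k M) :
    TensorProduct.map (TensorAlgebra.lift k (TensorAlgebra.ι k ∘ₗ f)).toLinearMap
        (TensorAlgebra.lift k (TensorAlgebra.ι k ∘ₗ f)).toLinearMap (Y.comul x) =
      Y'.comul (TensorAlgebra.lift k (TensorAlgebra.ι k ∘ₗ f) x) := by
  -- Multiplicativity in `x` is available only for the operators on all of `T(M) ⊗ T(M)`, not for
  -- their values at `1 ⊗ 1`.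
  have key : ∀ z, TensorProduct.map (TensorAlgebra.lift k (TensorAlgebra.ι k ∘ₗ f)).toLinearMap
        (TensorAlgebra.lift k (TensorAlgebra.ι k ∘ₗ f)).toLinearMap
          (TensorAlgebra.lift k Y.comulGen x z) =
      TensorAlgebra.lift k Y'.comulGen (TensorAlgebra.lift k (TensorAlgebra.ι k ∘ₗ f) x)
        (TensorProduct.map (TensorAlgebra.lift k (TensorAlgebra.ι k ∘ₗ f)).toLinearMap
          (TensorAlgebra.lift k (TensorAlgebra.ι k ∘ₗ f)).toLinearMap z) := by
    induction x using TensorAlgebra.induction with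
    | algebraMap r => intro z; simp [Module.algebraMap_end_apply]
    | ι v => intro z; simpa using H.comulGen v z
    | mul a b ha hb => intro z; simp only [map_mul, Module.End.mul_apply, ha, hb]
    | add a b ha hb => intro z; simp only [map_add, LinearMap.add_apply, ha, hb]
  simpa [YetterDrinfeld.comul] using key (1 ⊗ₜ[k] 1)

/-- The preimage under `T(f)` of an ideal of the class that defines the Nichols algebra is again of
this class. Injectivity of `f` guarantees that the preimage lies in degrees at least two. -/
theorem isNicholsCoideal_comap (H : IsMorphismAlong j Y Y' f) (hf : Function.Injective f)
    {I : Ideal (TensorAlgebra k M')} (hI : Y'.IsNicholsCoideal I) :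
    Y.IsNicholsCoideal (I.comap (TensorAlgebra.lift k (TensorAlgebra.ι k ∘ₗ f))) where
  twoSided := by
    have := hI.twoSided
    infer_instance
  homogeneous := by
    intro n x hx
    have h := hI.homogeneous n hx
    rw [decompose_tensorAlgebraMap] at h
    exact h
  degree := by
    intro x hx
    rw [mem_iSup_range_ι_pow_iff]
    intro n hn
    refine tensorAlgebraMap_eq_zero hf hn (SetLike.coe_mem _) ?_
    rw [← decompose_tensorAlgebraMap]
    exact (mem_iSup_range_ι_pow_iff _).1 (hI.degree hx) n hn
  coideal := by
    intro x hx
    have h := hI.coideal _ hx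
    rw [coidealSpace_eq_ker I (I.restrictScalars k).mkQ (by simp), LinearMap.mem_ker, ← H.comul,
      ← LinearMap.comp_apply, ← TensorProduct.map_comp] at h
    rw [coidealSpace_eq_ker _
      ((I.restrictScalars k).mkQ ∘ₗ (TensorAlgebra.lift k (TensorAlgebra.ι k ∘ₗ f)).toLinearMap)]
    · exact h
    · rw [LinearMap.ker_comp, Submodule.ker_mkQ]; rfl

/-- The quotient of `T(M)` by the preimage of the defining ideal of `𝔅(M')` embeds into `𝔅(M')` and
maps onto `𝔅(M)`. -/
theorem finiteDimensional_nicholsAlgebra (H : IsMorphismAlong j Y Y' f)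
    (hf : Function.Injective f) [FiniteDimensional k Y'.NicholsAlgebra] :
    FiniteDimensional k Y.NicholsAlgebra := by
  let F := TensorAlgebra.lift k (TensorAlgebra.ι k ∘ₗ f)
  let J : Ideal (TensorAlgebra k M) := Y'.nicholsIdeal.comap F
  have hJ : J ≤ Y.nicholsIdeal :=
    le_sSup (H.isNicholsCoideal_comap hf Y'.isNicholsCoideal_nicholsIdeal)
  let φ : TensorAlgebra k M →ₗ[k] Y'.NicholsAlgebra :=
    (Ideal.Quotient.mkₐ k Y'.nicholsIdeal).toLinearMap ∘ₗ F.toLinearMap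
  have hφ : LinearMap.ker φ ≤
      LinearMap.ker (Ideal.Quotient.mkₐ k Y.nicholsIdeal).toLinearMap := by
    intro x hx
    have hx' : F x ∈ Y'.nicholsIdeal := Ideal.Quotient.eq_zero_iff_mem.1 hx
    exact Ideal.Quotient.eq_zero_iff_mem.2 (hJ hx')
  have e := φ.quotKerEquivRange
  have : FiniteDimensional k (TensorAlgebra k M ⧸ LinearMap.ker φ) :=
    Module.Finite.equiv e.symm
  refine Module.Finite.of_surjective ((LinearMap.ker φ).liftQ _ hφ) ?_
  rw [← LinearMap.range_eq_top, Submodule.range_liftQ, LinearMap.range_eq_top]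
  exact Ideal.Quotient.mkₐ_surjective k _

end IsMorphismAlong

end YetterDrinfeld

/-! ### Irreducible subrepresentations -/

theorem Subrepresentation.isIrreducible_toRepresentation {k G W : Type*} [Field k] [Monoid G]
    [AddCommGroup W] [Module k W] {μ : Representation k G W} {σ : Subrepresentation μ}
    (hσ : IsAtom σ) : σ.toRepresentation.IsIrreducible := by
  have hne : Nontrivial σ.toSubmodule := by
    rw [Submodule.nontrivial_iff_ne_bot]
    exact fun h => hσ.1 (Subrepresentation.toSubmodule_injective h)
  have : Nontrivial (Subrepresentation σ.toRepresentation) :=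
    ⟨⊥, ⊤, fun h => bot_ne_top (α := Submodule k σ.toSubmodule)
      (congrArg Subrepresentation.toSubmodule h)⟩
  refine { eq_bot_or_eq_top := fun π => ?_ }
  let π' : Subrepresentation μ :=
    { toSubmodule := π.toSubmodule.map σ.toSubmodule.subtype
      apply_mem_toSubmodule := by
        rintro g _ ⟨v, hv, rfl⟩
        exact ⟨_, π.apply_mem_toSubmodule g hv, rfl⟩ }
  have hle : π' ≤ σ := Submodule.map_subtype_le _ _
  have hinj := Submodule.map_injective_of_injective (Submodule.injective_subtype σ.toSubmodule)
  rcases hσ.le_iff.1 hle with h | h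
  · refine Or.inl (Subrepresentation.toSubmodule_injective (hinj ?_))
    exact (congrArg Subrepresentation.toSubmodule h).trans (Submodule.map_bot _).symm
  · refine Or.inr (Subrepresentation.toSubmodule_injective (hinj ?_))
    exact (congrArg Subrepresentation.toSubmodule h).trans (Submodule.map_subtype_top _).symm

/-- By Maschke's theorem a nonzero representation of a finite group is semisimple, hence has an
irreducible subrepresentation, without any assumption on its dimension. -/
theorem Representation.exists_isIrreducible_toRepresentation {k G W : Type*} [Field k] [Group G]
    [Finite G] [NeZero (Nat.card G : k)] [AddCommGroup W] [Module k W] [Nontrivial W]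
    (μ : Representation k G W) :
    ∃ σ : Subrepresentation μ, σ.toRepresentation.IsIrreducible := by
  have : Nontrivial μ.asModule := ‹Nontrivial W›
  have : IsAtomic (Subrepresentation μ) :=
    (OrderIso.isAtomic_iff Subrepresentation.subrepresentationSubmoduleOrderIso).2
      (inferInstance : IsAtomic (Submodule k[G] μ.asModule))
  have : Nontrivial (Subrepresentation μ) :=
    ⟨⊥, ⊤, fun h => bot_ne_top (α := Submodule k W) (congrArg Subrepresentation.toSubmodule h)⟩
  obtain ⟨σ, hσ⟩ := IsAtomic.exists_atom (Subrepresentation μ)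
  exact ⟨σ, σ.isIrreducible_toRepresentation hσ⟩

theorem Representation.IsIrreducible.nontrivial {k G W : Type*} [Field k] [Monoid G]
    [AddCommGroup W] [Module k W] {μ : Representation k G W} (hμ : μ.IsIrreducible) :
    Nontrivial W := by
  by_contra h
  rw [not_nontrivial_iff_subsingleton] at h
  obtain ⟨x, y, hxy⟩ := hμ.toNontrivial
  exact hxy (Subrepresentation.toSubmodule_injective (Subsingleton.elim _ _))

/-! ### Comparison of conjugacy classes and their Yetter–Drinfeld modules -/

namespace ConjTransversal

variable {G G' : Type*} [Group G] [Group G'] {s : G}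

/-- The homomorphism from the centralizer of `s` to the centralizer of `j s` induced by `j`. -/
def centralizerMap (j : G →* G') (s : G) :
    Subgroup.centralizer ({s} : Set G) →* Subgroup.centralizer ({j s} : Set G') :=
  (j.comp (Subgroup.subtype _)).codRestrict _ fun x => by
    rw [Subgroup.mem_centralizer_singleton_iff]
    have hx := Subgroup.mem_centralizer_singleton_iff.1 x.2
    simpa using congrArg j hx

/-- The map `t ↦ j t` from the conjugacy class of `s` to the conjugacy class of `j s`. -/
def mapClass (j : G →* G') (t : conjugatesOf s) : conjugatesOf (j s) :=
  ⟨j t, j.map_isConj t.2⟩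

theorem mapClass_injective {j : G →* G'} (hj : Function.Injective j) :
    Function.Injective (mapClass j : conjugatesOf s → conjugatesOf (j s)) :=
  fun _ _ h => Subtype.ext (hj (congrArg Subtype.val h))

theorem mapClass_conjBy (j : G →* G') (h : G) (t : conjugatesOf s) :
    mapClass j (conjBy h t) = conjBy (j h) (mapClass j t) := by
  ext; simp [mapClass, conjBy]

/-- The element `γ_t` of the centralizer of `j s` with `j (g_t) = g'_{j t} γ_t`, where `g` and `g'` are
the chosen transversals of the two classes. -/
def comparison (j : G →* G') (T : ConjTransversal s) (T' : ConjTransversal (j s))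
    (t : conjugatesOf s) : Subgroup.centralizer ({j s} : Set G') :=
  ⟨(T'.g (mapClass j t))⁻¹ * j (T.g t), by
    rw [Subgroup.mem_centralizer_singleton_iff]
    have h1 : T'.g (mapClass j t) * j s * (T'.g (mapClass j t))⁻¹ =
        j (T.g t) * j s * (j (T.g t))⁻¹ := by
      rw [T'.conj, ← map_inv, ← map_mul, ← map_mul, T.conj]; rfl
    generalize T'.g (mapClass j t) = x at h1 ⊢
    generalize j (T.g t) = y at h1 ⊢
    calc x⁻¹ * y * j s = x⁻¹ * (y * j s * y⁻¹) * y := by group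
      _ = j s * (x⁻¹ * y) := by rw [← h1]; group⟩

/-- Both sides are the element `x` with `g'_{j t'} x = j (h g_t)`, where `t' = h t h⁻¹`. -/
theorem cocycle_mul_comparison (j : G →* G') (T : ConjTransversal s) (T' : ConjTransversal (j s))
    (h : G) (t : conjugatesOf s) :
    T'.cocycle (j h) (mapClass j t) * comparison j T T' t =
      comparison j T T' (conjBy h t) * centralizerMap j s (T.cocycle h t) := by
  ext
  simp [cocycle, comparison, centralizerMap, mapClass_conjBy, mul_assoc]

variable {k V W : Type*} [Field k] [AddCommGroup V] [Module k V] [AddCommGroup W] [Module k W]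

/-- The linear map `g_t v ↦ g'_{j t} (γ_t · e v)` from `⨁ₜ g_t ⊗ V` to `⨁ₜ g'_t ⊗ W`, for a linear map
`e : V → W`. -/
noncomputable def ydMap (j : G →* G') (T : ConjTransversal s) (T' : ConjTransversal (j s))
    (μ : Representation k (Subgroup.centralizer ({j s} : Set G')) W) (e : V →ₗ[k] W) :
    (conjugatesOf s →₀ V) →ₗ[k] (conjugatesOf (j s) →₀ W) :=
  Finsupp.lsum k fun t => Finsupp.lsingle (mapClass j t) ∘ₗ μ (comparison j T T' t) ∘ₗ e

theorem ydMap_single (j : G →* G') (T : ConjTransversal s) (T' : ConjTransversal (j s))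
    (μ : Representation k (Subgroup.centralizer ({j s} : Set G')) W) (e : V →ₗ[k] W)
    (t : conjugatesOf s) (v : V) : ydMap j T T' μ e (Finsupp.single t v) =
      Finsupp.single (mapClass j t) (μ (comparison j T T' t) (e v)) := by
  simp [ydMap]

theorem ydMap_injective {j : G →* G'} (hj : Function.Injective j) (T : ConjTransversal s)
    (T' : ConjTransversal (j s))
    (μ : Representation k (Subgroup.centralizer ({j s} : Set G')) W) {e : V →ₗ[k] W}
    (he : Function.Injective e) : Function.Injective (ydMap j T T' μ e) := by
  have key : ∀ (t : conjugatesOf s) (x : conjugatesOf s →₀ V),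
      ydMap j T T' μ e x (mapClass j t) = μ (comparison j T T' t) (e (x t)) := by
    intro t x
    induction x using Finsupp.induction_linear with
    | zero => simp
    | add x y hx hy => simp [hx, hy]
    | single r v =>
      rw [ydMap_single]
      by_cases h : r = t
      · subst h; simp
      · rw [Finsupp.single_eq_of_ne' ((mapClass_injective hj).ne h), Finsupp.single_eq_of_ne' h]
        simp
  intro x y hxy
  ext t
  have h := key t x
  rw [hxy, key t y] at h
  exact (he ((μ.apply_bijective _).1 h)).symm

/-- If `e` intertwines `ρ` with the restriction of `μ` along `j`, then `ydMap` is a morphism of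
Yetter–Drinfeld modules along `j`. -/
theorem isMorphismAlong_ydMap (j : G →* G') (T : ConjTransversal s) (T' : ConjTransversal (j s))
    (ρ : Representation k (Subgroup.centralizer ({s} : Set G)) V)
    (μ : Representation k (Subgroup.centralizer ({j s} : Set G')) W) (e : V →ₗ[k] W)
    (he : ∀ x v, e (ρ x v) = μ (centralizerMap j s x) (e v)) :
    (T.yd ρ).IsMorphismAlong j (T'.yd μ) (ydMap j T T' μ e) where
  act h := by
    ext t v : 2
    have := congrArg (fun x => μ x (e v)) (cocycle_mul_comparison j T T' h t)
    simp only [map_mul, Module.End.mul_apply] at this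
    simp [yd, ydAct_single, ydMap_single, he, mapClass_conjBy, this]
  coact := by
    ext t v : 2
    simp [yd, ydCoact_single, ydMap_single, mapClass]

/-- If the Nichols algebras of the class of `s` are infinite-dimensional for all irreducible
representations of its centralizer, then the same holds for the class of the image of `s` under an
injective homomorphism, and every nonzero representation of the centralizer there. -/
theorem not_finiteDimensional_nichols_of_injective {k : Type*} [Field k] [CharZero k] [Finite G]
    {s' : G'} {j : G →* G'} (hj : Function.Injective j) (hs : j s = s') (T : ConjTransversal s)
    (T' : ConjTransversal s')
    (h : ∀ (V : Type u) [AddCommGroup V] [Module k V]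
      (ρ : Representation k (Subgroup.centralizer ({s} : Set G)) V),
      ρ.IsIrreducible → ¬ FiniteDimensional k (T.Nichols ρ))
    {W : Type u} [AddCommGroup W] [Module k W] [Nontrivial W]
    (μ : Representation k (Subgroup.centralizer ({s'} : Set G')) W) :
    ¬ FiniteDimensional k (T'.Nichols μ) := by
  subst hs
  intro hfin
  obtain ⟨σ, hσ⟩ := Representation.exists_isIrreducible_toRepresentation
    (MonoidHom.comp μ (centralizerMap j s) :
      Representation k (Subgroup.centralizer ({s} : Set G)) W)
  refine h _ σ.toRepresentation hσ ?_
  exact (isMorphismAlong_ydMap j T T' σ.toRepresentation μ σ.toSubmodule.subtype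
    fun _ _ => rfl).finiteDimensional_nicholsAlgebra
      (ydMap_injective hj T T' μ (Submodule.injective_subtype _))

end ConjTransversal

/-! ### The embedding of `ℤ₂ⁿ ⋊ 𝕊ₙ` into `ℤ₂ⁿ⁺¹ ⋊ 𝕊ₙ₊₁` -/

namespace WeylB

/-- The embedding of `𝕊ₙ` into `𝕊ₙ₊₁` as the stabilizer of the last letter. -/
def extendPermHom (n : ℕ) : Equiv.Perm (Fin n) →* Equiv.Perm (Fin (n + 1)) where
  toFun := extendPerm
  map_one' := by
    ext i : 1
    induction i using Fin.lastCases <;> simp [extendPerm]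
  map_mul' σ τ := by
    ext i : 1
    induction i using Fin.lastCases <;> simp [extendPerm]

/-- The embedding `(a, τ) ↦ ((a, 0), τ)`. The last entry is written `1` because the coefficient group
`ℤ₂` is in multiplicative notation. -/
def extendHom (n : ℕ) : WeylB n →* WeylB (n + 1) :=
  SemidirectProduct.map
    { toFun := fun a => Fin.snoc (α := fun _ => Multiplicative (ZMod 2)) a 1
      map_one' := by
        ext i : 1
        induction i using Fin.lastCases <;> simp
      map_mul' := fun a b => by
        ext i : 1
        induction i using Fin.lastCases <;> simp }
    (extendPermHom n) fun τ => by
      refine MonoidHom.ext fun a => funext fun i => ?_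
      change Fin.snoc (α := fun _ => Multiplicative (ZMod 2)) (fun i => a (τ⁻¹ i)) 1 i =
        Fin.snoc (α := fun _ => Multiplicative (ZMod 2)) a 1 ((extendPerm τ)⁻¹ i)
      rw [show (extendPerm τ)⁻¹ = extendPerm τ⁻¹ from (map_inv (extendPermHom n) τ).symm]
      induction i using Fin.lastCases <;> simp [extendPerm]

theorem extendHom_mk {n : ℕ} (a : Fin n → ZMod 2) (τ : Equiv.Perm (Fin n)) :
    extendHom n (mk a τ) = mk (extendVec a) (extendPerm τ) := by
  ext : 1
  · funext i
    induction i using Fin.lastCases <;> simp [extendHom, mk, extendVec]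
  · rfl

theorem extendHom_injective (n : ℕ) : Function.Injective (extendHom n) := by
  intro x y h
  ext i : 2
  · have := congrFun (congrArg SemidirectProduct.left h) i.castSucc
    simpa [extendHom] using this
  · have := DFunLike.congr_fun (congrArg SemidirectProduct.right h) i.castSucc
    simpa [extendHom, extendPermHom, extendPerm] using this

end WeylB

theorem lemma3p5 (n : ℕ) (a : Fin n → ZMod 2) (τ : Equiv.Perm (Fin n))
    (T : ConjTransversal (WeylB.mk a τ))
    (T' : ConjTransversal (WeylB.mk (WeylB.extendVec a) (WeylB.extendPerm τ)))
    (h : ∀ (V : Type u) [AddCommGroup V] [Module ℂ V]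
      (ρ : Representation ℂ (Subgroup.centralizer ({WeylB.mk a τ} : Set (WeylB n))) V),
      ρ.IsIrreducible → ¬ FiniteDimensional ℂ (T.Nichols ρ)) :
    ∀ (W : Type u) [AddCommGroup W] [Module ℂ W]
      (μ : Representation ℂ
        (Subgroup.centralizer
          ({WeylB.mk (WeylB.extendVec a) (WeylB.extendPerm τ)} : Set (WeylB (n + 1)))) W),
      μ.IsIrreducible → ¬ FiniteDimensional ℂ (T'.Nichols μ) := by
  intro W _ _ μ hμ
  have := hμ.nontrivial
  have : Finite (WeylB n) := Finite.of_equiv _ SemidirectProduct.equivProd.symm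
  exact ConjTransversal.not_finiteDimensional_nichols_of_injective
    (WeylB.extendHom_injective n) (WeylB.extendHom_mk a τ) T T' h μ
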